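/- There is a universal constant $C$ such that the following holds. Let $G=(V,E)$ be a finite connected graph with $n\ge 1$ nodes and edge weights $w(e)\ge 1$ ($w\equiv 1$ in the unweighted case), and let $d_G$ be its weighted shortest-path distance. **Queueing cost.** A set of requests consists of a dummy request $r_0=(v_0,0)$ and finitely many further requests $r_1,\dots,r_m$, $r_i=(v_i,t_i)$ with $v_i\in V$ and $t_i\ge 0$. For a distance function $D$ on $V$, the optimal offline cost $\mathrm{OPT}_D$ is the minimum of $$\sum_{i=1}^{m}\max\{D(v_{\pi(i-1)},v_{\pi(i)}),\;t_{\pi(i-1)}-t_{\pi(i)}\}$$ over all permutations $\pi$ of $\{0,\dots,m\}$ with $\pi(0)=0$. The optimal offline queueing cost on $G$ is $\mathrm{OPT}_{d_G}$. **The random tree of Fakcharoenphol, Rao and Talwar (FRT).** Choose a uniformly random ordering of $V$ and, independently, $\beta\in[1,2]$ with density $1/(x\ln 2)$. Let $k\in\mathbb{N}$ be minimal with $d_G(x,y)\le 2^k$ for all $x,y$, and let $h=k+1$. The only cluster of level $h$ is $V$. For $\ell=h-1,\dots,0$, each cluster of level $\ell+1$ is split into clusters of level $\ell$ by letting the nodes,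 in the random order, take all its still unassigned nodes at $d_G$-distance less than $2^{\ell-2}\beta$ from them. The clusters of level $0$ are singletons. The tree $T$ has one node for each level $\ell\in\{0,\dots,h\}$ and each cluster of level $\ell$, and a cluster of level $\ell+1$ is joined to the clusters of level $\ell$ contained in it by edges of length $2^\ell$. So $T$ is a hierarchically well separated tree (HST) with parameter $2$ and depth $h$, whose leaves correspond to the nodes of $G$. Let $d_T(x,y)$ be the distance in $T$ between the leaves of $x,y\in V$. **Claim.** If the (possibly random) sequence of requests is independent of the randomness used to construct $T$, then $$\mathbb{E}\big[\mathrm{OPT}_{d_T}\big]\;\le\; C\,\log n\cdot \mathbb{E}\big[\mathrm{OPT}_{d_G}\big].$$ In particular, for every fixed sequence of requests, $\mathbb{E}[\mathrm{OPT}_{d_T}]\le C\,\log n\cdot \mathrm{OPT}_{d_G}$. -/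

import Mathlib

open MeasureTheory ProbabilityTheory
open scoped NNReal ENNReal

universe u v

namespace Queueing

/-- The length of a walk in a graph with edge weights `w`. -/
def walkLength {V : Type*} {G : SimpleGraph V} (w : Sym2 V → ℝ) {x y : V} (p : G.Walk x y) : ℝ :=
  (p.edges.map w).sum

/-- The shortest-path distance in a graph with (nonnegative) edge weights `w`.
Only used between vertices that are connected by a walk. -/
noncomputable def wdist {V : Type*} (G : SimpleGraph V) (w : Sym2 V → ℝ) (x y : V) : ℝ :=
  ⨅ p : G.Walk x y, walkLength w p

/-! ### Requests and the optimal offline cost -/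

/-- A queueing instance: the node `v₀` of the dummy request `r₀ = (v₀, 0)` (the initial tail of the
queue), and finitely many further requests, each of them a node with a nonnegative issue time. -/
def Requests (V : Type*) : Type _ := V × (Σ m : ℕ, (Fin m → V × ℝ≥0))

/-- The node set is discrete, times carry the Borel sets, and the number of requests is discrete. -/
instance (V : Type*) : MeasurableSpace (Requests V) :=
  letI : MeasurableSpace V := ⊤
  inferInstanceAs (MeasurableSpace (V × (Σ m : ℕ, (Fin m → V × ℝ≥0))))

/-- The number of requests besides the dummy request, that is `|R| - 1`. -/
def Requests.num {V : Type*} (R : Requests V) : ℕ := R.2.1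

/-- The requests `r₀, r₁, …, r_{|R|-1}`, where `r₀ = (v₀, 0)` is the dummy request. -/
def Requests.req {V : Type*} (R : Requests V) : Fin (R.num + 1) → V × ℝ≥0 :=
  Fin.cons (R.1, 0) R.2.2

/-- The latency cost `max {D(v, v'), t - t'}` of ordering the request `r' = (v', t')` as the
successor of `r = (v, t)`, with respect to the distance `D`. -/
noncomputable def latency {V : Type*} (D : V → V → ℝ) (r r' : V × ℝ≥0) : ℝ :=
  max (D r.1 r'.1) ((r.2 : ℝ) - (r'.2 : ℝ))

/-- The total cost of ordering the requests as `r_{π(0)}, r_{π(1)}, …, r_{π(|R|-1)}`. -/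
noncomputable def orderCost {V : Type*} (D : V → V → ℝ) (R : Requests V)
    (π : Equiv.Perm (Fin (R.num + 1))) : ℝ :=
  ∑ i : Fin R.num, latency D (R.req (π i.castSucc)) (R.req (π i.succ))

/-- The optimal offline cost with respect to the distance `D`: the minimum of the total cost over
all orderings of the requests that start with the dummy request. -/
noncomputable def optCost {V : Type*} (D : V → V → ℝ) (R : Requests V) : ℝ :=
  ⨅ π : {π : Equiv.Perm (Fin (R.num + 1)) // π 0 = 0}, orderCost D R π.1

/-! ### The random tree of Fakcharoenphol, Rao and Talwar -/

/-- An ordering of the points; `σ x` is the position of `x`. -/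
abbrev PointOrder (V : Type*) [Fintype V] : Type _ := V ≃ Fin (Fintype.card V)

instance (V : Type*) [Fintype V] : MeasurableSpace (PointOrder V) := ⊤

/-- The random choices of the algorithm: an ordering of the points and a number `β`. -/
abbrev Seed (V : Type*) [Fintype V] : Type _ := PointOrder V × ℝ

/-- The distribution of `β`: density `1 / (x ln 2)` on the interval `[1, 2]`. -/
noncomputable def betaLaw : Measure ℝ :=
  (volume.restrict (Set.Icc 1 2)).withDensity fun x => ENNReal.ofReal (1 / (x * Real.log 2))

/-- The ordering is uniformly random, and `β` is independent of it. -/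
noncomputable def seedLaw (V : Type*) [Fintype V] : Measure (Seed V) :=
  (uniformOn (Set.univ : Set (PointOrder V))).prod betaLaw

section Tree

variable {V : Type*} [Fintype V] (d : V → V → ℝ) (s : Seed V)

/-- The depth `h` of the tree: `h - 1` is the least natural number `k` for which all distances are
at most `2 ^ k`. -/
noncomputable def depth : ℕ := sInf {k : ℕ | ∀ x y, d x y ≤ 2 ^ k} + 1

/-- The radius `2 ^ (ℓ - 2) * β` used to form the clusters of level `ℓ < h`. It is at most `1` on
the levels `0` and `1`, so that (for distances at least `1`) their clusters are singletons. -/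
noncomputable def radius (ℓ : ℕ) : ℝ := 2 ^ ℓ / 4 * s.2

/-- The position of the first point, in the random ordering, that is closer to `x` than the
radius of level `ℓ`. -/
noncomputable def center (ℓ : ℕ) (x : V) : ℕ :=
  sInf {l : ℕ | ∃ y : V, (s.1 y : ℕ) = l ∧ d x y < radius s ℓ}

/-- The cluster of level `ℓ` that contains `x`. The only cluster of level `h` is the whole space;
the clusters of level `ℓ < h` arise from those of level `ℓ + 1` by going through the points in the
random ordering, each point taking from each cluster the still unassigned points that are closer to
it than the radius of level `ℓ`. So two points are in the same cluster of level `ℓ` if and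
only if they are taken by the same point on each of the levels `ℓ, …, h - 1`. -/
def cluster (ℓ : ℕ) (x : V) : Set V :=
  {y | ∀ k, ℓ ≤ k → k < depth d → center d s k y = center d s k x}

/-- The nodes of the tree: pairs of a level `ℓ ∈ {0, …, h}` and a cluster of level `ℓ`. -/
structure Node where
  level : ℕ
  points : Set V
  level_le : level ≤ depth d
  isCluster : ∃ x, points = cluster d s level x

/-- The tree: a cluster of level `ℓ + 1` is the parent of the clusters of level `ℓ` that it
contains. -/
def tree : SimpleGraph (Node d s) :=
  SimpleGraph.fromRel fun a b => a.level = b.level + 1 ∧ b.points ⊆ a.points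

/-- The edge between a node of level `ℓ + 1` and a child of level `ℓ` has length `2 ^ ℓ`. -/
noncomputable def treeWeight : Sym2 (Node d s) → ℝ :=
  Sym2.lift ⟨fun a b => (2 : ℝ) ^ min a.level b.level, fun _ _ => congrArg _ (min_comm _ _)⟩

/-- The leaf of the tree to which a point is mapped. -/
def leaf (x : V) : Node d s :=
  ⟨0, cluster d s 0 x, Nat.zero_le _, x, rfl⟩

/-- The distance in the tree between the leaves of two points. -/
noncomputable def treeDist (x y : V) : ℝ :=
  wdist (tree d s) (treeWeight d s) (leaf d s x) (leaf d s y)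

end Tree

end Queueing

namespace Queueing

/-! ### Weighted shortest-path distances. -/

section ShortestPath

variable {V : Type*} {G : SimpleGraph V} {w : Sym2 V → ℝ}

/-! One fixed ordering suffices: keep an ordering that is optimal for the graph distance d and
change only the distances. Since max{D, t - t'} ≤ D + (t - t')⁺, it is enough that the expected tree
distance of x and y is O(log n) · d(x, y) (`lintegral_cutBound_le`, `lintegral_iInf_sumCost_le`).

For this stretch bound, the tree distance is below 2^(l+2), where l is the top level on which x and
y have different centers (and 0 if there is none). On such a level let z be the first point within
the radius r of x or of y. Then r lies between the distances from z to x and to y, an interval of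
length at most d(x, y), and z precedes every point at least as close to {x, y}
(`exists_cut_of_center_ne`). The condition on r involves only β, and its total weight over all
levels is O(d(x, y)) in expectation; the condition on z involves only the ordering and has
probability at most 1 / rank(z). Summing over z gives the harmonic number.

Measurability of the optimal costs is never needed: on the tree side `cutBound` and `sumCost` yield
a jointly measurable majorant, to which Tonelli applies by independence. -/

lemma walkLength_nonneg (hw : ∀ e ∈ G.edgeSet, 0 ≤ w e) {x y : V} (p : G.Walk x y) :
    0 ≤ walkLength w p := by
  refine List.sum_nonneg fun a ha => ?_
  obtain ⟨e, he, rfl⟩ := List.mem_map.1 ha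
  exact hw e (p.edges_subset_edgeSet he)

lemma walkLength_append {x y z : V} (p : G.Walk x y) (q : G.Walk y z) :
    walkLength w (p.append q) = walkLength w p + walkLength w q := by
  simp [walkLength, SimpleGraph.Walk.edges_append]

lemma walkLength_reverse {x y : V} (p : G.Walk x y) :
    walkLength w p.reverse = walkLength w p := by
  simp [walkLength, SimpleGraph.Walk.edges_reverse, List.sum_reverse]

lemma wdist_le_walkLength (hw : ∀ e ∈ G.edgeSet, 0 ≤ w e) {x y : V} (p : G.Walk x y) :
    wdist G w x y ≤ walkLength w p :=
  ciInf_le ⟨0, by rintro _ ⟨q, rfl⟩; exact walkLength_nonneg hw q⟩ p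

lemma wdist_nonneg (hw : ∀ e ∈ G.edgeSet, 0 ≤ w e) (x y : V) : 0 ≤ wdist G w x y :=
  Real.iInf_nonneg fun p => walkLength_nonneg hw p

lemma wdist_self (hw : ∀ e ∈ G.edgeSet, 0 ≤ w e) (x : V) : wdist G w x x = 0 :=
  le_antisymm ((wdist_le_walkLength hw .nil).trans_eq (by simp [walkLength])) (wdist_nonneg hw x x)

lemma wdist_comm_le (hw : ∀ e ∈ G.edgeSet, 0 ≤ w e) (hG : G.Connected) (x y : V) :
    wdist G w x y ≤ wdist G w y x := by
  have : Nonempty (G.Walk y x) := hG.preconnected y x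
  exact le_ciInf fun p => (wdist_le_walkLength hw p.reverse).trans_eq (walkLength_reverse p)

lemma wdist_comm (hw : ∀ e ∈ G.edgeSet, 0 ≤ w e) (hG : G.Connected) (x y : V) :
    wdist G w x y = wdist G w y x :=
  le_antisymm (wdist_comm_le hw hG x y) (wdist_comm_le hw hG y x)

lemma wdist_triangle (hw : ∀ e ∈ G.edgeSet, 0 ≤ w e) (hG : G.Connected) (x y z : V) :
    wdist G w x z ≤ wdist G w x y + wdist G w y z := by
  have : Nonempty (G.Walk x y) := hG.preconnected x y
  have : Nonempty (G.Walk y z) := hG.preconnected y z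
  refine le_ciInf_add_ciInf fun p q => ?_
  exact (wdist_le_walkLength hw (p.append q)).trans_eq (walkLength_append p q)

end ShortestPath

/-! ### Upper bounds for the tree distance. -/

section Tree

variable {V : Type*} [Fintype V] (d : V → V → ℝ) (s : Seed V)

lemma treeWeight_nonneg (e : Sym2 (Node d s)) : 0 ≤ treeWeight d s e := by
  induction e with
  | _ a b => exact pow_nonneg zero_le_two _

lemma cluster_mono {k l : ℕ} (h : k ≤ l) (x : V) : cluster d s k x ⊆ cluster d s l x :=
  fun _ hy j hj hjd => hy j (h.trans hj) hjd

lemma cluster_eq {l : ℕ} {x y : V}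
    (h : ∀ k, l ≤ k → k < depth d → center d s k y = center d s k x) :
    cluster d s l x = cluster d s l y := by
  ext z
  exact forall₃_congr fun k hk hkd => by rw [h k hk hkd]

/-- The walk in the tree from a leaf to its ancestor of a given level. -/
lemma exists_walk_ancestor (x : V) (l : ℕ) (hl : l ≤ depth d) :
    ∃ p : (tree d s).Walk (leaf d s x) ⟨l, cluster d s l x, hl, x, rfl⟩,
      walkLength (treeWeight d s) p = 2 ^ l - 1 := by
  induction l with
  | zero =>
    have h : walkLength (treeWeight d s)
      (SimpleGraph.Walk.nil : (tree d s).Walk (leaf d s x) (leaf d s x)) = 2 ^ 0 - 1 := by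
      simp [walkLength]
    exact ⟨_, h⟩
  | succ l ih =>
    obtain ⟨p, hp⟩ := ih (by omega)
    have hadj : (tree d s).Adj ⟨l, cluster d s l x, by omega, x, rfl⟩
        ⟨l + 1, cluster d s (l + 1) x, hl, x, rfl⟩ := by
      rw [tree, SimpleGraph.fromRel_adj]
      exact ⟨fun h => by simpa using congrArg Node.level h,
        .inr ⟨rfl, cluster_mono d s (by omega) x⟩⟩
    refine ⟨p.append hadj.toWalk, ?_⟩
    rw [walkLength_append, hp]
    simp [walkLength, treeWeight]
    ring

/-- Climb from both leaves to the common ancestor. Only this upper bound on tree distances is used;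
that the tree dominates the graph plays no role. -/
lemma treeDist_le_of_cluster_eq (x y : V) (l : ℕ) (hl : l ≤ depth d)
    (h : cluster d s l x = cluster d s l y) : treeDist d s x y ≤ 2 * (2 ^ l - 1) := by
  obtain ⟨p, hp⟩ := exists_walk_ancestor d s x l hl
  obtain ⟨q, hq⟩ := exists_walk_ancestor d s y l hl
  have e : (⟨l, cluster d s l y, hl, y, rfl⟩ : Node d s) = ⟨l, cluster d s l x, hl, x, rfl⟩ := by
    simp [h]
  have := wdist_le_walkLength (fun e _ => treeWeight_nonneg d s e)
    (p.append ((q.copy rfl e).reverse))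
  rw [walkLength_append, walkLength_reverse, hp] at this
  have hq' : walkLength (treeWeight d s) (q.copy rfl e) = 2 ^ l - 1 := by
    rw [← hq, walkLength, walkLength, SimpleGraph.Walk.edges_copy]
  rw [hq'] at this
  rw [treeDist]
  linarith

lemma treeDist_nonneg (x y : V) : 0 ≤ treeDist d s x y :=
  wdist_nonneg (fun e _ => treeWeight_nonneg d s e) _ _

lemma treeDist_self (x : V) : treeDist d s x x = 0 :=
  wdist_self (fun e _ => treeWeight_nonneg d s e) _

open Classical in
/-- A level on which two points have different centers contributes at most `2 ^ (ℓ + 2)`. -/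
lemma treeDist_le_sum_center (x y : V) :
    treeDist d s x y ≤ ∑ l ∈ Finset.range (depth d),
      if center d s l x ≠ center d s l y then (2 : ℝ) ^ (l + 2) else 0 := by
  rw [← Finset.sum_filter]
  obtain ⟨B, hB⟩ : ∃ B, (Finset.range (depth d)).filter
    (fun l => center d s l x ≠ center d s l y) = B := ⟨_, rfl⟩
  have hmem : ∀ k, k ∈ B ↔ k < depth d ∧ center d s k x ≠ center d s k y := fun k => by
    simp [← hB]
  simp only [hB]
  have hnn : ∀ l ∈ B, (0 : ℝ) ≤ 2 ^ (l + 2) := fun l _ => by positivity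
  rcases B.eq_empty_or_nonempty with h0 | hne
  · rw [h0, Finset.sum_empty]
    refine (treeDist_le_of_cluster_eq d s x y 0 (Nat.zero_le _) ?_).trans_eq (by simp)
    refine cluster_eq d s fun k _ hk => ?_
    by_contra hc
    have : k ∈ B := (hmem k).2 ⟨hk, Ne.symm hc⟩
    simp [h0] at this
  -- Above the largest level `m` with different centers the clusters agree, so the paths meet at
  -- level `m + 1`.
  · obtain ⟨m, hm, hmax⟩ := B.exists_max_image id hne
    have hmd : m < depth d := ((hmem m).1 hm).1
    refine le_trans ?_ (Finset.single_le_sum hnn hm)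
    refine (treeDist_le_of_cluster_eq d s x y (m + 1) hmd ?_).trans ?_
    · refine cluster_eq d s fun k hmk hk => ?_
      by_contra hc
      have : k ∈ B := (hmem k).2 ⟨hk, Ne.symm hc⟩
      have := hmax k this
      simp only [id] at this
      omega
    · rw [pow_succ, pow_add]
      have : (0 : ℝ) < 2 ^ m := by positivity
      linarith

/-- The point `z` is the first of the points in `A`. -/
def firstIn (A : Set V) (z : V) : Set (PointOrder V) :=
  {σ | ∀ z' ∈ A, σ z ≤ σ z'}

/-- If two points have different centers, then some point `z` takes only one of them,
and it comes before all points that are at least as close to the two points. -/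
lemma exists_cut_of_center_ne {l : ℕ} {x y : V} (h : center d s l x ≠ center d s l y) :
    ∃ z, s.1 ∈ firstIn {z' | min (d x z') (d y z') ≤ min (d x z) (d y z)} z ∧
      radius s l ∈ Set.Ioc (min (d x z) (d y z)) (max (d x z) (d y z)) := by
  set r := radius s l
  have hne : {z | min (d x z) (d y z) < r}.Nonempty := by
    -- If no point is within `r` of `x` or `y`, both centers are the default `sInf ∅ = 0`, hence
    -- equal. So no assumption on β or on `d` is needed.
    by_contra hemp
    rw [Set.not_nonempty_iff_eq_empty, Set.eq_empty_iff_forall_notMem] at hemp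
    refine h ?_
    have hx : ∀ z, ¬ d x z < r := fun z hz => hemp z ((min_le_left _ _).trans_lt hz)
    have hy : ∀ z, ¬ d y z < r := fun z hz => hemp z ((min_le_right _ _).trans_lt hz)
    simp [center, r, hx, hy] at hx hy ⊢
  obtain ⟨z, hz, hmin⟩ := Set.exists_min_image _ s.1 (Set.toFinite _) hne
  have hcenter : ∀ u : V, (∀ z', d u z' < r → min (d x z') (d y z') < r) → d u z < r →
      center d s l u = s.1 z := by
    intro u hu huz
    refine IsLeast.csInf_eq ⟨⟨z, rfl, huz⟩, ?_⟩
    rintro _ ⟨z', rfl, hz'⟩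
    exact hmin z' (hu z' hz')
  refine ⟨z, fun z' hz' => hmin z' (lt_of_le_of_lt (Set.mem_ofPred.1 hz') hz), hz, ?_⟩
  -- If `z` were within `r` of both points, it would be the center of both.
  by_contra hlt
  rw [not_le, max_lt_iff] at hlt
  exact h ((hcenter x (fun z' => (min_le_left _ _).trans_lt) hlt.1).trans
    (hcenter y (fun z' => (min_le_right _ _).trans_lt) hlt.2).symm)

/-- An upper bound on the tree distance that depends on the seed in an explicit way. -/
noncomputable def cutBound (s : Seed V) (x y : V) : ℝ≥0∞ :=
  ∑ z, (firstIn {z' | min (d x z') (d y z') ≤ min (d x z) (d y z)} z).indicator 1 s.1 *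
    ∑ l ∈ Finset.range (depth d), (2 : ℝ≥0∞) ^ (l + 2) *
      {β : ℝ | 2 ^ l / 4 * β ∈ Set.Ioc (min (d x z) (d y z)) (max (d x z) (d y z))}.indicator 1 s.2

/-- A union bound over the cutting point `z`. Each summand of the bound is a function of the
ordering times a function of β, so its expectation factors. -/
lemma treeDist_le_cutBound (x y : V) : ENNReal.ofReal (treeDist d s x y) ≤ cutBound d s x y := by
  refine (ENNReal.ofReal_le_ofReal (treeDist_le_sum_center d s x y)).trans ?_
  rw [ENNReal.ofReal_sum_of_nonneg fun l _ => by positivity]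
  simp only [cutBound, Finset.mul_sum]
  rw [Finset.sum_comm]
  refine Finset.sum_le_sum fun l _ => ?_
  split_ifs with hc
  · obtain ⟨z, hz₁, hz₂⟩ := exists_cut_of_center_ne d s hc
    refine le_trans (le_of_eq ?_) (Finset.single_le_sum (fun _ _ => zero_le) (Finset.mem_univ z))
    have hz₂' : s.2 ∈ {β : ℝ | 2 ^ l / 4 * β ∈
      Set.Ioc (min (d x z) (d y z)) (max (d x z) (d y z))} := hz₂
    rw [Set.indicator_of_mem hz₁, Set.indicator_of_mem hz₂', ENNReal.ofReal_pow zero_le_two]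
    simp
  · simp

end Tree

end Queueing

namespace Queueing

/-! ### Expected stretch of the random tree. -/

section Seed

variable {V : Type*} [Fintype V]

/-- The first point of `A` in a uniformly random ordering is a fixed point of `A`
with probability at most `1 / |A|`. -/
lemma uniformOn_firstIn_le [DecidableEq V] (A : Finset V) {z : V} (hz : z ∈ A) :
    uniformOn (Set.univ : Set (PointOrder V)) (firstIn (A : Set V) z) ≤ (A.card : ℝ≥0∞)⁻¹ := by
  have hcount : ∀ z' ∈ A, Measure.count (firstIn (A : Set V) z') =
      Measure.count (firstIn (A : Set V) z) := by
    intro z' hz'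
    -- Relabelling by the transposition of `z` and `z'` preserves `A`, so all points of `A` are
    -- equally likely to come first.
    let f : PointOrder V → PointOrder V := fun σ => (Equiv.swap z z').trans σ
    have hf : Function.Injective f := fun σ τ h => by
      ext x
      have := congrArg (fun ρ : PointOrder V => ρ (Equiv.swap z z' x)) h
      simpa [f] using congrArg Fin.val this
    have himg : f '' firstIn (A : Set V) z = firstIn (A : Set V) z' := by
      have hswap : ∀ u ∈ A, Equiv.swap z z' u ∈ A := by
        intro u hu
        rw [Equiv.swap_apply_def]
        split_ifs <;> assumption
      ext τ
      constructor
      · rintro ⟨σ, hσ, rfl⟩ u hu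
        simpa [f] using hσ _ (hswap u hu)
      · intro hτ
        refine ⟨f τ, fun u hu => ?_, ?_⟩
        · simpa [f] using hτ _ (hswap u hu)
        · ext u; simp [f]
    rw [← himg, Measure.count_injective_image hf]
  have hdisj : Set.PairwiseDisjoint (A : Set V) (fun z' => firstIn (A : Set V) z') := by
    intro u hu u' hu' hne
    refine Set.disjoint_left.2 fun σ h h' => hne ?_
    exact σ.injective (le_antisymm (h u' hu') (h' u hu))
  have hsum : (A.card : ℝ≥0∞) * Measure.count (firstIn (A : Set V) z) ≤
      Fintype.card (PointOrder V) := by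
    calc (A.card : ℝ≥0∞) * Measure.count (firstIn (A : Set V) z)
        = ∑ z' ∈ A, Measure.count (firstIn (A : Set V) z') := by
          rw [Finset.sum_congr rfl hcount, Finset.sum_const, nsmul_eq_mul]
      _ = Measure.count (⋃ z' ∈ A, firstIn (A : Set V) z') :=
          (measure_biUnion_finset hdisj fun _ _ => .of_discrete).symm
      _ ≤ Measure.count (Set.univ : Set (PointOrder V)) := measure_mono (Set.subset_univ _)
      _ = _ := by simp [Measure.count_univ]
  have hA : (A.card : ℝ≥0∞) ≠ 0 := by simpa using Finset.ne_empty_of_mem hz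
  have hN : (Fintype.card (PointOrder V) : ℝ≥0∞) ≠ 0 := by
    have : Nonempty (PointOrder V) := ⟨Fintype.equivFin V⟩
    exact_mod_cast Fintype.card_ne_zero
  rw [uniformOn_univ]
  refine ENNReal.div_le_of_le_mul ?_
  rw [← ENNReal.div_eq_inv_mul, ENNReal.le_div_iff_mul_le (.inl hA) (.inl (by simp)), mul_comm]
  exact hsum

/-- Only the bound 1 / ln 2 on the density is used, not its exact form. -/
lemma betaLaw_le (s : Set ℝ) (hs : MeasurableSet s) :
    betaLaw s ≤ ENNReal.ofReal (1 / Real.log 2) * volume (s ∩ Set.Icc 1 2) := by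
  rw [betaLaw, withDensity_apply _ hs, Measure.restrict_restrict hs, ← setLIntegral_const]
  refine setLIntegral_mono measurable_const fun x hx => ENNReal.ofReal_le_ofReal ?_
  have hlog : 0 < Real.log 2 := Real.log_pos one_lt_two
  exact one_div_le_one_div_of_le hlog (le_mul_of_one_le_left hlog.le hx.2.1)

/-- The expected total scale of the levels whose radius separates `a` from `b`. -/
lemma lintegral_radius_le (a b : ℝ) (hab : a ≤ b) (h : ℕ) :
    ∫⁻ β, ∑ l ∈ Finset.range h, (2 : ℝ≥0∞) ^ (l + 2) *
      {β : ℝ | 2 ^ l / 4 * β ∈ Set.Ioc a b}.indicator 1 β ∂betaLaw ≤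
      ENNReal.ofReal (16 / Real.log 2 * (b - a)) := by
  have hlog : 0 < Real.log 2 := Real.log_pos one_lt_two
  have hmeas : ∀ l : ℕ, MeasurableSet {β : ℝ | 2 ^ l / 4 * β ∈ Set.Ioc a b} := fun l =>
    (measurable_const_mul ((2 : ℝ) ^ l / 4)) measurableSet_Ioc
  -- For β in [1, 2] the radius of level `l` lies in [2^l / 4, 2^(l+1) / 4]. These intervals overlap
  -- only at endpoints; clamping the endpoints to [a, b] makes the sum over levels telescope.
  let c : ℕ → ℝ := fun l => max a (min b (2 ^ l / 4))
  have hcmono : ∀ l, c l ≤ c (l + 1) := fun l => by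
    refine max_le_max le_rfl (min_le_min le_rfl ?_)
    gcongr <;> simp
  have hterm : ∀ l : ℕ, (2 : ℝ≥0∞) ^ (l + 2) * betaLaw {β : ℝ | 2 ^ l / 4 * β ∈ Set.Ioc a b} ≤
      ENNReal.ofReal (16 / Real.log 2 * (c (l + 1) - c l)) := by
    intro l
    have hp : (0 : ℝ) < 2 ^ l := by positivity
    have hsub : {β : ℝ | 2 ^ l / 4 * β ∈ Set.Ioc a b} ∩ Set.Icc 1 2 ⊆
        Set.Icc (4 / 2 ^ l * c l) (4 / 2 ^ l * c (l + 1)) := by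
      rintro β ⟨⟨h₁, h₂⟩, h₃, h₄⟩
      have e : β = 4 / 2 ^ l * (2 ^ l / 4 * β) := by field_simp
      rw [e]
      constructor
      · refine mul_le_mul_of_nonneg_left ?_ (by positivity)
        refine max_le h₁.le ((min_le_right _ _).trans ?_)
        exact le_mul_of_one_le_right (by positivity) h₃
      · refine mul_le_mul_of_nonneg_left ?_ (by positivity)
        refine le_max_of_le_right (le_min h₂ ?_)
        rw [pow_succ]
        nlinarith
    -- The weight 2^(l+2) cancels the scaling 4 / 2^l from radii to β and leaves the factor 16.
    calc (2 : ℝ≥0∞) ^ (l + 2) * betaLaw {β : ℝ | 2 ^ l / 4 * β ∈ Set.Ioc a b}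
        ≤ ENNReal.ofReal (2 ^ (l + 2)) * (ENNReal.ofReal (1 / Real.log 2) *
            ENNReal.ofReal (4 / 2 ^ l * c (l + 1) - 4 / 2 ^ l * c l)) := by
          refine mul_le_mul' ?_ ((betaLaw_le _ (hmeas l)).trans (mul_le_mul' le_rfl ?_))
          · rw [ENNReal.ofReal_pow zero_le_two]; simp
          · exact (measure_mono hsub).trans_eq Real.volume_Icc
      _ = _ := by
          rw [← ENNReal.ofReal_mul (by positivity), ← ENNReal.ofReal_mul (by positivity)]
          congr 1
          rw [pow_add]
          field_simp
          ring
  calc ∫⁻ β, ∑ l ∈ Finset.range h, (2 : ℝ≥0∞) ^ (l + 2) *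
        {β : ℝ | 2 ^ l / 4 * β ∈ Set.Ioc a b}.indicator 1 β ∂betaLaw
      = ∑ l ∈ Finset.range h, (2 : ℝ≥0∞) ^ (l + 2) *
          betaLaw {β : ℝ | 2 ^ l / 4 * β ∈ Set.Ioc a b} := by
        rw [lintegral_finsetSum _ fun l _ =>
          (measurable_one.indicator (hmeas l)).const_mul _]
        refine Finset.sum_congr rfl fun l _ => ?_
        rw [lintegral_const_mul _ (measurable_one.indicator (hmeas l)),
          lintegral_indicator_one (hmeas l)]
    _ ≤ ∑ l ∈ Finset.range h, ENNReal.ofReal (16 / Real.log 2 * (c (l + 1) - c l)) :=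
        Finset.sum_le_sum fun l _ => hterm l
    _ = ENNReal.ofReal (16 / Real.log 2 * (c h - c 0)) := by
        rw [← ENNReal.ofReal_sum_of_nonneg fun l _ =>
          mul_nonneg (by positivity) (sub_nonneg.2 (hcmono l)), ← Finset.mul_sum,
          Finset.sum_range_sub]
    _ ≤ _ := by
        refine ENNReal.ofReal_le_ofReal (mul_le_mul_of_nonneg_left ?_ (by positivity))
        exact sub_le_sub (max_le hab (min_le_left _ _)) (le_max_left _ _)

/-- The sum of the reciprocal ranks is at most the harmonic number. -/
lemma sum_inv_rank_le_harmonic {ι : Type*} [DecidableEq ι] (a : ι → ℝ) (s : Finset ι) :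
    ∑ z ∈ s, ((s.filter fun z' => a z' ≤ a z).card : ℝ)⁻¹ ≤ (harmonic s.card : ℝ) := by
  induction s using Finset.induction_on_max_value a with
  | empty => simp
  | insert m s hm hmax ih =>
    rw [Finset.sum_insert hm, Finset.card_insert_of_notMem hm, harmonic_succ, add_comm]
    push_cast
    -- The inserted maximum has rank `s.card + 1`; the ranks of the other points can only grow,
    -- through ties.
    refine add_le_add ((Finset.sum_le_sum fun z hz => ?_).trans ih) (le_of_eq ?_)
    · have hpos : 0 < (s.filter fun z' => a z' ≤ a z).card :=
        Finset.card_pos.2 ⟨z, by simp [hz]⟩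
      have hle := Finset.card_le_card
        (Finset.filter_subset_filter (fun z' => a z' ≤ a z) (Finset.subset_insert m s))
      exact inv_anti₀ (by exact_mod_cast hpos) (by exact_mod_cast hle)
    · rw [Finset.filter_true_of_mem, Finset.card_insert_of_notMem hm]
      · push_cast; rfl
      · intro z hz
        rcases Finset.mem_insert.1 hz with rfl | hz
        exacts [le_rfl, hmax z hz]

lemma measurable_cutBound (d : V → V → ℝ) (x y : V) :
    Measurable fun s : Seed V => cutBound d s x y := by
  unfold cutBound
  refine Finset.measurable_fun_sum _ fun z _ => Measurable.mul ?_ ?_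
  · exact (measurable_from_top (f := Set.indicator _ _)).comp measurable_fst
  · refine Finset.measurable_fun_sum _ fun l _ => Measurable.const_mul ?_ _
    have hs : MeasurableSet {β : ℝ | 2 ^ l / 4 * β ∈
        Set.Ioc (min (d x z) (d y z)) (max (d x z) (d y z))} :=
      (measurable_const_mul ((2 : ℝ) ^ l / 4)) measurableSet_Ioc
    exact (measurable_one.indicator hs).comp measurable_snd

instance : SFinite betaLaw := by
  unfold betaLaw; infer_instance

/-- The expected stretch of the random tree is logarithmic. -/
lemma lintegral_cutBound_le [Nonempty V] (d : V → V → ℝ) (hcomm : ∀ x y, d x y = d y x)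
    (htri : ∀ x y z, d x z ≤ d x y + d y z) (x y : V) :
    ∫⁻ s, cutBound d s x y ∂seedLaw V ≤
      ENNReal.ofReal (16 / Real.log 2 * harmonic (Fintype.card V) * d x y) := by
  classical
  have hlog : 0 < Real.log 2 := Real.log_pos one_lt_two
  have hd : 0 ≤ d x y := by linarith [htri x y x, hcomm x y, htri x x x]
  set a : V → ℝ := fun z => min (d x z) (d y z) with ha
  set b : V → ℝ := fun z => max (d x z) (d y z) with hb
  have hba : ∀ z, b z - a z ≤ d x y := fun z => by
    rw [ha, hb, max_sub_min_eq_abs, abs_sub_le_iff]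
    constructor <;> linarith [htri x y z, htri y x z, hcomm x y]
  have hA : ∀ z, MeasurableSet (firstIn {z' | a z' ≤ a z} z) := fun z => .of_discrete
  have hB : ∀ (l : ℕ) z, MeasurableSet {β : ℝ | 2 ^ l / 4 * β ∈ Set.Ioc (a z) (b z)} := fun l z =>
    (measurable_const_mul ((2 : ℝ) ^ l / 4)) measurableSet_Ioc
  have hf : ∀ z, Measurable ((firstIn {z' | a z' ≤ a z} z).indicator (1 : PointOrder V → ℝ≥0∞)) :=
    fun z => measurable_one.indicator (hA z)
  have hg : ∀ z, Measurable fun β => ∑ l ∈ Finset.range (depth d), (2 : ℝ≥0∞) ^ (l + 2) *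
      {β : ℝ | 2 ^ l / 4 * β ∈ Set.Ioc (a z) (b z)}.indicator 1 β := fun z =>
    Finset.measurable_fun_sum _ fun l _ => (measurable_one.indicator (hB l z)).const_mul _
  have hterm : ∀ z, ∫⁻ s : Seed V, (firstIn {z' | a z' ≤ a z} z).indicator 1 s.1 *
      ∑ l ∈ Finset.range (depth d), (2 : ℝ≥0∞) ^ (l + 2) *
        {β : ℝ | 2 ^ l / 4 * β ∈ Set.Ioc (a z) (b z)}.indicator 1 s.2 ∂seedLaw V ≤
      ENNReal.ofReal (((Finset.univ.filter fun z' => a z' ≤ a z).card : ℝ)⁻¹ *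
        (16 / Real.log 2 * d x y)) := by
    intro z
    have hz : z ∈ Finset.univ.filter fun z' => a z' ≤ a z := by simp
    rw [seedLaw, lintegral_prod_mul (hf z).aemeasurable (hg z).aemeasurable,
      lintegral_indicator_one (hA z), ENNReal.ofReal_mul (by positivity)]
    refine mul_le_mul' ?_ ((lintegral_radius_le _ _ min_le_max _).trans ?_)
    · have := uniformOn_firstIn_le _ hz
      rw [Finset.coe_filter_univ] at this
      refine this.trans_eq ?_
      rw [ENNReal.ofReal_inv_of_pos (by exact_mod_cast Finset.card_pos.2 ⟨z, hz⟩),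
        ENNReal.ofReal_natCast]
    · exact ENNReal.ofReal_le_ofReal (mul_le_mul_of_nonneg_left (hba z) (by positivity))
  calc ∫⁻ s, cutBound d s x y ∂seedLaw V
      = ∑ z, ∫⁻ s : Seed V, (firstIn {z' | a z' ≤ a z} z).indicator 1 s.1 *
          ∑ l ∈ Finset.range (depth d), (2 : ℝ≥0∞) ^ (l + 2) *
            {β : ℝ | 2 ^ l / 4 * β ∈ Set.Ioc (a z) (b z)}.indicator 1 s.2 ∂seedLaw V :=
        lintegral_finsetSum _ fun z _ =>
          ((hf z).comp measurable_fst).mul ((hg z).comp measurable_snd)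
    _ ≤ ∑ z, ENNReal.ofReal (((Finset.univ.filter fun z' => a z' ≤ a z).card : ℝ)⁻¹ *
          (16 / Real.log 2 * d x y)) := Finset.sum_le_sum fun z _ => hterm z
    _ = ENNReal.ofReal ((∑ z, ((Finset.univ.filter fun z' => a z' ≤ a z).card : ℝ)⁻¹) *
          (16 / Real.log 2 * d x y)) := by
        rw [← ENNReal.ofReal_sum_of_nonneg fun z _ => by positivity, Finset.sum_mul]
    _ ≤ _ := by
        refine ENNReal.ofReal_le_ofReal ?_
        rw [mul_right_comm, mul_comm]
        exact mul_le_mul_of_nonneg_left (sum_inv_rank_le_harmonic a Finset.univ) (by positivity)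

end Seed

end Queueing

namespace Queueing

/-! ### Joint measurability in the requests and the seed. -/

section Measurability

variable {V : Type*}

lemma measurable_requests_mk (v : V) (m : ℕ) :
    letI : MeasurableSpace V := ⊤
    Measurable fun q : Fin m → V × ℝ≥0 => ((v, ⟨m, q⟩) : Requests V) := by
  let : MeasurableSpace V := ⊤
  have hS : Measurable (@Sigma.mk ℕ (fun m => Fin m → V × ℝ≥0) m) :=
    fun s hs => (MeasurableSpace.measurableSet_iInf.1 hs) m
  exact measurable_const.prodMk hS

lemma measurableEmbedding_requests_mk (v : V) (m : ℕ) :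
    letI : MeasurableSpace V := ⊤
    MeasurableEmbedding fun q : Fin m → V × ℝ≥0 => ((v, ⟨m, q⟩) : Requests V) := by
  let : MeasurableSpace V := ⊤
  refine ⟨fun q q' h => ?_, measurable_requests_mk v m, fun s hs => ?_⟩
  · simpa using congrArg Prod.snd h
  · have hS :
        MeasurableSet ((@Sigma.mk ℕ (fun m => Fin m → V × ℝ≥0) m) '' s) := by
      refine MeasurableSpace.measurableSet_iInf.2 fun n => ?_
      change MeasurableSet (@Sigma.mk ℕ (fun m => Fin m → V × ℝ≥0) n ⁻¹' _)
      rcases eq_or_ne m n with rfl | hne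
      · rwa [Set.preimage_image_eq _ sigma_mk_injective]
      · convert MeasurableSet.empty
        ext q
        simp only [Set.mem_preimage, Set.mem_image, Set.mem_empty_iff_false, iff_false]
        rintro ⟨q', -, h⟩
        exact hne (congrArg Sigma.fst h)
    have : (fun q : Fin m → V × ℝ≥0 => ((v, ⟨m, q⟩) : Requests V)) '' s =
        ({v} : Set V) ×ˢ (Sigma.mk m '' s) := by
      ext ⟨u, t⟩
      simp only [Set.mem_image, Set.mem_prod, Set.mem_singleton_iff]
      constructor
      · rintro ⟨q, hq, h⟩
        exact ⟨(congrArg Prod.fst h).symm, q, hq, congrArg Prod.snd h⟩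
      · rintro ⟨h, q, hq, h'⟩
        exact ⟨q, hq, Prod.ext h.symm h'⟩
    rw [this]
    exact MeasurableSet.prod (MeasurableSpace.measurableSet_top) hS

/-- Measurability of a function of the requests and a parameter may be checked separately for
each node of the dummy request and each number of requests. -/
lemma measurable_requests_prod [Countable V] {α β : Type*} [MeasurableSpace α] [MeasurableSpace β]
    {f : Requests V × α → β}
    (hf : letI : MeasurableSpace V := ⊤
      ∀ v m, Measurable fun p : (Fin m → V × ℝ≥0) × α => f ((v, ⟨m, p.1⟩), p.2)) :
    Measurable f := by
  let : MeasurableSpace V := ⊤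
  intro s hs
  let e : ∀ (v : V) (m : ℕ), (Fin m → V × ℝ≥0) × α → Requests V × α :=
    fun v m => Prod.map (fun q => ((v, ⟨m, q⟩) : Requests V)) id
  -- The space of requests is a countable union of measurably embedded pieces, one for each `v` and
  -- `m`.
  have he : f ⁻¹' s = ⋃ v : V, ⋃ m : ℕ, e v m '' ((fun p => f (e v m p)) ⁻¹' s) := by
    ext ⟨⟨v, m, q⟩, a⟩
    simp only [Set.mem_preimage, Set.mem_iUnion, Set.mem_image]
    constructor
    · intro h
      exact ⟨v, m, (q, a), h, rfl⟩
    · rintro ⟨v', m', p, hp, h⟩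
      rwa [← h]
  rw [he]
  refine MeasurableSet.iUnion fun v => MeasurableSet.iUnion fun m => ?_
  exact ((measurableEmbedding_requests_mk v m).prodMap MeasurableEmbedding.id).measurableSet_image.2
    (hf v m hs)

/-- The cost of an ordering, with the maximum in the latency replaced by a sum. -/
noncomputable def sumCost (b : V → V → ℝ≥0∞) (R : Requests V)
    (π : Equiv.Perm (Fin (R.num + 1))) : ℝ≥0∞ :=
  ∑ i : Fin R.num, (b (R.req (π i.castSucc)).1 (R.req (π i.succ)).1 +
    ENNReal.ofReal ((R.req (π i.castSucc)).2 - (R.req (π i.succ)).2))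

lemma measurable_sumCost [Countable V] {α : Type*} [MeasurableSpace α]
    {b : α → V → V → ℝ≥0∞} (hb : ∀ x y, Measurable fun a => b a x y) (v : V) (m : ℕ)
    (π : Equiv.Perm (Fin (m + 1))) :
    letI : MeasurableSpace V := ⊤
    Measurable fun p : (Fin m → V × ℝ≥0) × α => sumCost (b p.2) (v, ⟨m, p.1⟩) π := by
  let : MeasurableSpace V := ⊤
  have hreq : ∀ j, Measurable fun p : (Fin m → V × ℝ≥0) × α =>
      (Fin.cons (v, 0) p.1 : Fin (m + 1) → V × ℝ≥0) j := by
    intro j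
    cases j using Fin.cases with
    | zero => exact measurable_const (a := ((v, 0) : V × ℝ≥0))
    | succ j => exact (measurable_pi_apply j).comp measurable_fst
  have hb' : Measurable fun q : (V × V) × α => b q.2 q.1.1 q.1.2 :=
    measurable_from_prod_countable_right fun q => hb q.1 q.2
  have hterm : ∀ i j, Measurable fun p : (Fin m → V × ℝ≥0) × α =>
      b p.2 ((Fin.cons (v, 0) p.1 : Fin (m + 1) → V × ℝ≥0) i).1
          ((Fin.cons (v, 0) p.1 : Fin (m + 1) → V × ℝ≥0) j).1 +
        ENNReal.ofReal (((Fin.cons (v, 0) p.1 : Fin (m + 1) → V × ℝ≥0) i).2 -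
          ((Fin.cons (v, 0) p.1 : Fin (m + 1) → V × ℝ≥0) j).2) := fun i j =>
    (hb'.comp (((hreq i).fst.prodMk (hreq j).fst).prodMk measurable_snd)).add
      ((hreq i).snd.coe_nnreal_real.sub (hreq j).snd.coe_nnreal_real).ennreal_ofReal
  exact Finset.measurable_fun_sum Finset.univ fun (i : Fin m) _ => hterm (π i.castSucc) (π i.succ)

lemma measurable_iInf_sumCost [Countable V] {α : Type*} [MeasurableSpace α]
    {b : α → V → V → ℝ≥0∞} (hb : ∀ x y, Measurable fun a => b a x y) :
    Measurable fun p : Requests V × α =>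
      ⨅ π : {π : Equiv.Perm (Fin (p.1.num + 1)) // π 0 = 0}, sumCost (b p.2) p.1 π.1 := by
  have h : letI : MeasurableSpace V := ⊤
      ∀ v m, Measurable fun p : (Fin m → V × ℝ≥0) × α =>
        ⨅ π : {π : Equiv.Perm (Fin (m + 1)) // π 0 = 0}, sumCost (b p.2) (v, ⟨m, p.1⟩) π.1 :=
    fun v m => Measurable.iInf fun π => measurable_sumCost hb v m π.1
  exact measurable_requests_prod h

end Measurability

/-! ### Comparison of optimal costs. -/

section Cost

variable {V : Type*} (D : V → V → ℝ) (R : Requests V)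

variable {D} in
lemma latency_nonneg (hD : ∀ x y, 0 ≤ D x y) (r r' : V × ℝ≥0) : 0 ≤ latency D r r' :=
  (hD _ _).trans (le_max_left _ _)

instance : Nonempty {π : Equiv.Perm (Fin (R.num + 1)) // π 0 = 0} := ⟨⟨1, rfl⟩⟩

lemma optCost_le_orderCost (π : {π : Equiv.Perm (Fin (R.num + 1)) // π 0 = 0}) :
    optCost D R ≤ orderCost D R π.1 :=
  ciInf_le (Set.finite_range _).bddBelow π

lemma exists_orderCost_eq_optCost :
    ∃ π : {π : Equiv.Perm (Fin (R.num + 1)) // π 0 = 0}, orderCost D R π.1 = optCost D R :=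
  exists_eq_ciInf_of_finite

lemma ofReal_optCost_le_iInf_sumCost (hD : ∀ x y, 0 ≤ D x y) (b : V → V → ℝ≥0∞)
    (hb : ∀ x y, ENNReal.ofReal (D x y) ≤ b x y) :
    ENNReal.ofReal (optCost D R) ≤
      ⨅ π : {π : Equiv.Perm (Fin (R.num + 1)) // π 0 = 0}, sumCost b R π.1 := by
  refine le_iInf fun π => (ENNReal.ofReal_le_ofReal (optCost_le_orderCost D R π)).trans ?_
  rw [orderCost, ENNReal.ofReal_sum_of_nonneg fun i _ => latency_nonneg hD _ _]
  refine Finset.sum_le_sum fun i _ => ?_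
  rw [latency, ENNReal.ofReal_max]
  exact max_le ((hb _ _).trans le_self_add) le_add_self

/-- If the expectation of `b` is at most a multiple of `D`, then the expectation of the minimum
cost with respect to `b` is at most a multiple of the optimal cost with respect to `D`. -/
lemma lintegral_iInf_sumCost_le {α : Type*} [MeasurableSpace α] (ν : Measure α)
    [IsProbabilityMeasure ν] {b : α → V → V → ℝ≥0∞} (hbm : ∀ x y, Measurable fun a => b a x y)
    (hD : ∀ x y, 0 ≤ D x y) {K : ℝ} (hK : 0 ≤ K)
    (hb : ∀ x y, ∫⁻ a, b a x y ∂ν ≤ ENNReal.ofReal (K * D x y)) :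
    ∫⁻ a, ⨅ π : {π : Equiv.Perm (Fin (R.num + 1)) // π 0 = 0}, sumCost (b a) R π.1 ∂ν ≤
      ENNReal.ofReal ((K + 1) * optCost D R) := by
  -- The ordering optimal for `D` is used for every `a`, so it can be taken out of the integral.
  obtain ⟨π, hπ⟩ := exists_orderCost_eq_optCost D R
  refine (lintegral_mono fun a => iInf_le _ π).trans ?_
  unfold sumCost
  rw [← hπ, orderCost, Finset.mul_sum, ENNReal.ofReal_sum_of_nonneg fun i _ =>
    mul_nonneg (by positivity) (latency_nonneg hD _ _),
    lintegral_finsetSum _ fun i _ => (hbm _ _).add_const _]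
  refine Finset.sum_le_sum fun i _ => ?_
  rw [lintegral_add_right _ measurable_const, lintegral_const, measure_univ, mul_one,
    add_mul, one_mul, ENNReal.ofReal_add (mul_nonneg hK (latency_nonneg hD _ _))
      (latency_nonneg hD _ _)]
  refine add_le_add ((hb _ _).trans ?_) (ENNReal.ofReal_le_ofReal (le_max_right _ _))
  exact ENNReal.ofReal_le_ofReal (mul_le_mul_of_nonneg_left (le_max_left _ _) hK)

/-- Ordering the requests of a single node by time is free. -/
lemma optCost_nonpos_of_subsingleton [Subsingleton V] (hD : ∀ x, D x x = 0) :
    optCost D R ≤ 0 := by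
  let t : Fin (R.num + 1) → ℝ≥0 := fun i => (R.req i).2
  have ht : t 0 = 0 := rfl
  let σ := Tuple.sort t
  have hmono : Monotone (t ∘ σ) := Tuple.monotone_sort t
  have hσ0 : t (σ 0) = 0 := by
    have := hmono (Fin.zero_le (σ⁻¹ 0))
    simpa [ht] using this
  -- Sorting need not put the dummy first if other requests have time 0. The swap exchanges it with
  -- the first one, which also has time 0, so the order of times is unchanged.
  let π : Equiv.Perm (Fin (R.num + 1)) := σ * Equiv.swap 0 (σ⁻¹ 0)
  have hπ0 : π 0 = 0 := by simp [π]
  have hπ : t ∘ π = t ∘ σ := by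
    ext i
    simp only [π, Function.comp, Equiv.Perm.mul_apply, Equiv.swap_apply_def]
    split_ifs with h h'
    · simp [h, hσ0, ht]
    · simp [h', hσ0, ht]
    · rfl
  refine (optCost_le_orderCost D R ⟨π, hπ0⟩).trans (Finset.sum_nonpos fun i _ => ?_)
  refine max_le ?_ (sub_nonpos.2 ?_)
  · rw [Subsingleton.elim (R.req (π i.castSucc)).1 (R.req (π i.succ)).1, hD]
  · have : (t ∘ π) i.castSucc ≤ (t ∘ π) i.succ := hπ ▸ hmono i.castSucc_lt_succ.le
    exact_mod_cast this

end Cost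

/-! ### Independence and the final estimate. -/

/-- Applying an estimate for fixed requests to requests that are independent of the seed. -/
lemma lintegral_le_of_indepFun {Ω α β : Type*} [MeasurableSpace Ω] [MeasurableSpace α]
    [MeasurableSpace β] {μ : Measure Ω} [IsProbabilityMeasure μ] {ν : Measure α}
    {S : Ω → α} {R : Ω → β} (hS : HasLaw S ν μ) (hR : Measurable R) (h : IndepFun R S μ)
    {K : β × α → ℝ≥0∞} (hK : Measurable K) {F : β → ℝ≥0∞} (hF : ∀ r, ∫⁻ a, K (r, a) ∂ν ≤ F r) :
    ∫⁻ ω, K (R ω, S ω) ∂μ ≤ ∫⁻ ω, F (R ω) ∂μ := by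
  have := hS.isProbabilityMeasure_iff.1 ‹_›
  calc ∫⁻ ω, K (R ω, S ω) ∂μ = ∫⁻ p, K p ∂(μ.map fun ω => (R ω, S ω)) :=
        (lintegral_map' hK.aemeasurable (hR.aemeasurable.prodMk hS.aemeasurable)).symm
    _ = ∫⁻ r, ∫⁻ a, K (r, a) ∂ν ∂(μ.map R) := by
        rw [(indepFun_iff_map_prod_eq_prod_map_map hR.aemeasurable hS.aemeasurable).1 h,
          hS.map_eq, lintegral_prod _ hK.aemeasurable]
    _ ≤ ∫⁻ r, F r ∂(μ.map R) := lintegral_mono hF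
    -- This inequality holds without measurability of `F`, here a multiple of the optimal cost on
    -- the graph.
    _ ≤ ∫⁻ ω, F (R ω) ∂μ := lintegral_map_le _ _

/-- For n ≥ 2 additive constants are absorbed, since 1 ≤ log n / log 2. -/
lemma stretch_le_log {n : ℕ} (hn : 2 ≤ n) :
    16 / Real.log 2 * harmonic n + 1 ≤
      (16 / Real.log 2 * (1 / Real.log 2 + 1) + 1 / Real.log 2) * Real.log n := by
  have hlog : 0 < Real.log 2 := Real.log_pos one_lt_two
  have h2 : Real.log 2 ≤ Real.log n := Real.log_le_log two_pos (by exact_mod_cast hn)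
  have h1 : 1 ≤ 1 / Real.log 2 * Real.log n := by
    rw [one_div_mul_eq_div]
    exact (one_le_div hlog).2 h2
  calc 16 / Real.log 2 * harmonic n + 1
      ≤ 16 / Real.log 2 * (1 / Real.log 2 * Real.log n + Real.log n) +
        1 / Real.log 2 * Real.log n := by
        refine add_le_add (mul_le_mul_of_nonneg_left ?_ (by positivity)) h1
        exact (harmonic_le_one_add_log n).trans (by linarith)
    _ = _ := by ring

end Queueing

theorem lemma1 :
    ∃ C : ℝ≥0, ∀ (V : Type u) [Fintype V] (G : SimpleGraph V) (w : Sym2 V → ℝ),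
      G.Connected → (∀ e ∈ G.edgeSet, 1 ≤ w e) →
      ∀ (Ω : Type v) [MeasurableSpace Ω] (μ : Measure Ω) [IsProbabilityMeasure μ]
        (S : Ω → Queueing.Seed V) (R : Ω → Queueing.Requests V),
        HasLaw S (Queueing.seedLaw V) μ → Measurable R → IndepFun R S μ →
        ∫⁻ ω, ENNReal.ofReal
            (Queueing.optCost (Queueing.treeDist (Queueing.wdist G w) (S ω)) (R ω)) ∂μ ≤
          ENNReal.ofReal (C * Real.log (Fintype.card V)) *
            ∫⁻ ω, ENNReal.ofReal (Queueing.optCost (Queueing.wdist G w) (R ω)) ∂μ := by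
  have hlog : 0 < Real.log 2 := Real.log_pos one_lt_two
  refine ⟨⟨16 / Real.log 2 * (1 / Real.log 2 + 1) + 1 / Real.log 2, by positivity⟩, ?_⟩
  intro V _ G w hG hw Ω _ μ _ S R hS hR hRS
  have hw0 : ∀ e ∈ G.edgeSet, 0 ≤ w e := fun e he => zero_le_one.trans (hw e he)
  have := hG.nonempty
  rcases (Nat.one_le_iff_ne_zero.2 Fintype.card_ne_zero : 1 ≤ Fintype.card V).eq_or_lt with h1 | h2
  -- For n = 1 the factor log n vanishes, so the cost on the tree must be exactly 0.
  · have : Subsingleton V := Fintype.card_le_one_iff_subsingleton.1 h1.ge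
    refine le_of_eq_of_le ?_ zero_le
    simp [ENNReal.ofReal_eq_zero.2 (Queueing.optCost_nonpos_of_subsingleton _ (R _)
      (Queueing.treeDist_self (Queueing.wdist G w) (S _)))]
  · have hprob := hS.isProbabilityMeasure_iff.1 ‹_›
    have hd0 := Queueing.wdist_nonneg (G := G) hw0
    have hharm : (0 : ℝ) ≤ harmonic (Fintype.card V) := by
      exact_mod_cast Finset.sum_nonneg fun i _ => by positivity
    calc ∫⁻ ω, ENNReal.ofReal
          (Queueing.optCost (Queueing.treeDist (Queueing.wdist G w) (S ω)) (R ω)) ∂μ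
        ≤ ∫⁻ ω, ⨅ π : {π : Equiv.Perm (Fin ((R ω).num + 1)) // π 0 = 0},
            Queueing.sumCost (Queueing.cutBound (Queueing.wdist G w) (S ω)) (R ω) π.1 ∂μ :=
          lintegral_mono fun ω => Queueing.ofReal_optCost_le_iInf_sumCost _ _
            (Queueing.treeDist_nonneg _ _) _ (Queueing.treeDist_le_cutBound _ _)
      _ ≤ ∫⁻ ω, ENNReal.ofReal ((16 / Real.log 2 * harmonic (Fintype.card V) + 1) *
            Queueing.optCost (Queueing.wdist G w) (R ω)) ∂μ :=
          Queueing.lintegral_le_of_indepFun hS hR hRS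
            (K := fun p => ⨅ π : {π : Equiv.Perm (Fin (p.1.num + 1)) // π 0 = 0},
              Queueing.sumCost (Queueing.cutBound (Queueing.wdist G w) p.2) p.1 π.1)
            (F := fun r => ENNReal.ofReal ((16 / Real.log 2 * harmonic (Fintype.card V) + 1) *
              Queueing.optCost (Queueing.wdist G w) r))
            (Queueing.measurable_iInf_sumCost (Queueing.measurable_cutBound _))
            fun r => Queueing.lintegral_iInf_sumCost_le _ r _ (Queueing.measurable_cutBound _)
              hd0 (by positivity) (Queueing.lintegral_cutBound_le _
                (Queueing.wdist_comm hw0 hG) (Queueing.wdist_triangle hw0 hG))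
      _ = ENNReal.ofReal (16 / Real.log 2 * harmonic (Fintype.card V) + 1) *
            ∫⁻ ω, ENNReal.ofReal (Queueing.optCost (Queueing.wdist G w) (R ω)) ∂μ := by
          rw [← lintegral_const_mul' _ _ ENNReal.ofReal_ne_top]
          simp_rw [ENNReal.ofReal_mul (show 0 ≤ 16 / Real.log 2 *
            (harmonic (Fintype.card V) : ℝ) + 1 by positivity)]
      _ ≤ _ := mul_le_mul' (ENNReal.ofReal_le_ofReal (Queueing.stretch_le_log h2)) le_rfl
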